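/- For a metric space $X$ and an integer $n\ge 0$, say that $X$ has asymptotic dimension at most $n$ if for every $d>0$ there are $R$ and $n+1$ families $\mathcal U_0,\dots,\mathcal U_n$ of subsets of $X$ which together cover $X$, such that every member of each $\mathcal U_i$ has diameter at most $R$ and any two points lying in different members of the same $\mathcal U_i$ are at distance greater than $d$. Let $\operatorname{asdim}X\in\mathbb N\cup\{\infty\}$ be the least such $n$ ($\infty$ if there is none). For a finitely generated group $F$, let $\operatorname{asdim}F$ be the asymptotic dimension of $F$ with the word metric of a finite generating set (it does not depend on the generating set). For an arbitrary group $G$, let $$\operatorname{asdim}G=\sup\{\operatorname{asdim}F \mid F\le G\ \text{a finitely generated subgroup}\}.$$ For every short exact sequence of abelian groups $0\to B\to A\to C\to 0$, $$\operatorname{asdim}A=\operatorname{asdim}B+\operatorname{asdim}C$$ in $\mathbb N\cup\{\infty\}$. In particular, for all abelian groups $A$ and $B$, $\operatorname{asdim}(A\times B)=\operatorname{asdim}A+\operatorname{asdim}B$. -/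

import Mathlib

universe u v w

noncomputable section

namespace AsymptoticDimension

/-! ### Asymptotic dimension of metric spaces -/

/-- A family `𝒰` of subsets of a metric space is `R`-bounded if all its members have diameter
at most `R`. -/
def IsBoundedFamily {X : Type u} [MetricSpace X] (R : ℝ) (𝒰 : Set (Set X)) : Prop :=
  ∀ U ∈ 𝒰, ∀ x ∈ U, ∀ y ∈ U, dist x y ≤ R

/-- A family `𝒰` of subsets of a metric space is `d`-disjoint if points of two different members
of `𝒰` are at distance greater than `d`. -/
def IsDisjointFamily {X : Type u} [MetricSpace X] (d : ℝ) (𝒰 : Set (Set X)) : Prop :=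
  ∀ U ∈ 𝒰, ∀ V ∈ 𝒰, U ≠ V → ∀ x ∈ U, ∀ y ∈ V, d < dist x y

/-- `X` has asymptotic dimension at most `n`: for every `d > 0` there are `R` and `n + 1` families
of subsets of `X`, each `d`-disjoint and `R`-bounded, which together cover `X`. -/
def HasAsdimLE (X : Type u) [MetricSpace X] (n : ℕ) : Prop :=
  ∀ d : ℝ, 0 < d → ∃ (R : ℝ) (𝒰 : Fin (n + 1) → Set (Set X)),
    (∀ i, IsDisjointFamily d (𝒰 i)) ∧ (∀ i, IsBoundedFamily R (𝒰 i)) ∧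
      ∀ x : X, ∃ i, ∃ U ∈ 𝒰 i, x ∈ U

/-- The asymptotic dimension of a metric space: the least `n` such that `X` has asymptotic
dimension at most `n`, and `⊤` if there is none. -/
def metricAsdim (X : Type u) [MetricSpace X] : ℕ∞ :=
  sInf {k : ℕ∞ | ∃ n : ℕ, k = n ∧ HasAsdimLE X n}

/-! ### Word metrics

Groups are written additively, but need not be commutative. -/

section Word

variable {G : Type u} [AddGroup G]

/-- `IsWord S l`: all letters of `l` lie in `S` or in `-S`. -/
def IsWord (S : Set G) (l : List G) : Prop := ∀ x ∈ l, x ∈ S ∨ -x ∈ S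

/-- The word norm: the least length of a word in `S` and `-S` which evaluates to `g`
(used only when `S` generates `G`, so that there are such words). -/
def wordNorm (S : Set G) (g : G) : ℕ :=
  sInf {n : ℕ | ∃ l : List G, IsWord S l ∧ l.sum = g ∧ l.length = n}

theorem exists_word {S : Set G} (hS : AddSubgroup.closure S = ⊤) (g : G) :
    ∃ l : List G, IsWord S l ∧ l.sum = g := by
  have hg : g ∈ AddSubgroup.closure S := by rw [hS]; trivial
  rw [← AddSubgroup.mem_toAddSubmonoid, AddSubgroup.closure_toAddSubmonoid] at hg
  obtain ⟨l, hl, h⟩ := AddSubmonoid.exists_list_of_mem_closure hg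
  exact ⟨l, fun x hx => by simpa using hl x hx, h⟩

theorem exists_word_length_eq {S : Set G} (hS : AddSubgroup.closure S = ⊤) (g : G) :
    ∃ l : List G, IsWord S l ∧ l.sum = g ∧ l.length = wordNorm S g := by
  obtain ⟨l, hl, hg⟩ := exists_word hS g
  exact Nat.sInf_mem (s := {n : ℕ | ∃ l : List G, IsWord S l ∧ l.sum = g ∧ l.length = n})
    ⟨l.length, l, hl, hg, rfl⟩

theorem wordNorm_le {S : Set G} {l : List G} (hl : IsWord S l) : wordNorm S l.sum ≤ l.length :=
  Nat.sInf_le ⟨l, hl, rfl, rfl⟩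

theorem wordNorm_zero (S : Set G) : wordNorm S (0 : G) = 0 := by
  have h : IsWord S ([] : List G) := by intro x hx; simp at hx
  simpa using wordNorm_le h

theorem eq_zero_of_wordNorm {S : Set G} (hS : AddSubgroup.closure S = ⊤) {g : G}
    (h : wordNorm S g = 0) : g = 0 := by
  obtain ⟨l, -, hg, hn⟩ := exists_word_length_eq hS g
  rw [h, List.length_eq_zero_iff] at hn
  simpa [hn] using hg.symm

theorem wordNorm_add_le {S : Set G} (hS : AddSubgroup.closure S = ⊤) (g h : G) :
    wordNorm S (g + h) ≤ wordNorm S g + wordNorm S h := by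
  obtain ⟨l, hl, rfl, hn⟩ := exists_word_length_eq hS g
  obtain ⟨m, hm, rfl, hk⟩ := exists_word_length_eq hS h
  have hw : IsWord S (l ++ m) := by
    intro x hx
    rcases List.mem_append.1 hx with hx | hx
    exacts [hl x hx, hm x hx]
  have := wordNorm_le hw
  rw [List.sum_append, List.length_append] at this
  omega

theorem wordNorm_neg_le {S : Set G} (hS : AddSubgroup.closure S = ⊤) (g : G) :
    wordNorm S (-g) ≤ wordNorm S g := by
  obtain ⟨l, hl, rfl, hn⟩ := exists_word_length_eq hS g
  have hw : IsWord S (l.map (fun x => -x)).reverse := by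
    intro x hx
    rw [List.mem_reverse, List.mem_map] at hx
    obtain ⟨y, hy, rfl⟩ := hx
    rw [neg_neg]
    exact (hl y hy).symm
  have := wordNorm_le hw
  rw [← List.sum_neg_reverse, List.length_reverse, List.length_map] at this
  omega

theorem wordNorm_neg {S : Set G} (hS : AddSubgroup.closure S = ⊤) (g : G) :
    wordNorm S (-g) = wordNorm S g :=
  le_antisymm (wordNorm_neg_le hS g) (by simpa using wordNorm_neg_le hS (-g))

/-- The (left invariant) word metric `d(x, y) = ‖-x + y‖` of a generating set `S`. -/
@[reducible] def wordMetric (S : Set G) (hS : AddSubgroup.closure S = ⊤) : MetricSpace G where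
  dist x y := wordNorm S (-x + y)
  dist_self x := by simp [wordNorm_zero]
  dist_comm x y := by
    have : -y + x = -(-x + y) := by simp
    rw [this, wordNorm_neg hS]
  dist_triangle x y z := by
    have h := wordNorm_add_le hS (-x + y) (-y + z)
    rw [show -x + y + (-y + z) = -x + z by simp [add_assoc]] at h
    exact_mod_cast h
  eq_of_dist_eq_zero := by
    intro x y h
    have h0 : wordNorm S (-x + y) = 0 := by exact_mod_cast h
    have := eq_zero_of_wordNorm hS h0
    exact (neg_add_eq_zero.1 this)

end Word

/-! ### Asymptotic dimension of groups -/

/-- The asymptotic dimension of a finitely generated group: that of the word metric of a finite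
generating set. It does not depend on the generating set, nor on the choice of a proper left
invariant metric, see `fgAsdim_eq_of_proper` and `fgAsdim_eq_of_closure` below. -/
def fgAsdim (F : Type u) [AddGroup F] (h : AddGroup.FG F) : ℕ∞ :=
  @metricAsdim F (wordMetric (h.out.choose : Set F) h.out.choose_spec)

/-- The asymptotic dimension of an arbitrary group: the supremum of the asymptotic dimensions of
its finitely generated subgroups. -/
def asdim (G : Type u) [AddGroup G] : ℕ∞ :=
  ⨆ (F : AddSubgroup G) (h : AddGroup.FG F), fgAsdim F h

/-! ### The asymptotic dimension of a finitely generated group is well defined -/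

theorem HasAsdimLE.of_coarse {X : Type u} (m₁ m₂ : MetricSpace X) {n : ℕ}
    (h₁ : ∀ r : ℝ, ∃ s : ℝ, ∀ x y : X, m₁.dist x y ≤ r → m₂.dist x y ≤ s)
    (h₂ : ∀ r : ℝ, ∃ s : ℝ, ∀ x y : X, m₂.dist x y ≤ r → m₁.dist x y ≤ s)
    (h : @HasAsdimLE X m₂ n) : @HasAsdimLE X m₁ n := by
  intro d _
  obtain ⟨s, hs⟩ := h₁ d
  obtain ⟨R, 𝒰, hd, hb, hc⟩ := h (max s 1) (lt_max_of_lt_right one_pos)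
  obtain ⟨R', hR'⟩ := h₂ R
  refine ⟨R', 𝒰, ?_, ?_, hc⟩
  · intro i U hU V hV hUV x hx y hy
    by_contra hle
    exact absurd ((hs x y (not_lt.1 hle)).trans (le_max_left s 1))
      (not_le.2 (hd i U hU V hV hUV x hx y hy))
  · intro i U hU x hx y hy
    exact hR' x y (hb i U hU x hx y hy)

theorem exists_dist_le {G : Type u} [AddGroup G] (m₁ m₂ : MetricSpace G)
    (hl₁ : ∀ g x y : G, m₁.dist (g + x) (g + y) = m₁.dist x y)
    (hp₁ : ∀ r : ℝ, {x : G | m₁.dist 0 x ≤ r}.Finite)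
    (hl₂ : ∀ g x y : G, m₂.dist (g + x) (g + y) = m₂.dist x y) (r : ℝ) :
    ∃ s : ℝ, ∀ x y : G, m₁.dist x y ≤ r → m₂.dist x y ≤ s := by
  obtain ⟨s, hs⟩ := ((hp₁ r).image (fun x => m₂.dist 0 x)).bddAbove
  refine ⟨s, fun x y hxy => ?_⟩
  have e₁ := hl₁ (-x) x y
  have e₂ := hl₂ (-x) x y
  rw [neg_add_cancel] at e₁ e₂
  rw [← e₂]
  exact hs ⟨-x + y, by rw [Set.mem_ofPred_eq, e₁]; exact hxy, rfl⟩

theorem metricAsdim_eq_of_proper {G : Type u} [AddGroup G] (m₁ m₂ : MetricSpace G)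
    (hl₁ : ∀ g x y : G, m₁.dist (g + x) (g + y) = m₁.dist x y)
    (hp₁ : ∀ r : ℝ, {x : G | m₁.dist 0 x ≤ r}.Finite)
    (hl₂ : ∀ g x y : G, m₂.dist (g + x) (g + y) = m₂.dist x y)
    (hp₂ : ∀ r : ℝ, {x : G | m₂.dist 0 x ≤ r}.Finite) :
    @metricAsdim G m₁ = @metricAsdim G m₂ := by
  have h₁ := exists_dist_le m₁ m₂ hl₁ hp₁ hl₂
  have h₂ := exists_dist_le m₂ m₁ hl₂ hp₂ hl₁
  have : ∀ n, @HasAsdimLE G m₁ n ↔ @HasAsdimLE G m₂ n := fun n =>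
    ⟨HasAsdimLE.of_coarse m₂ m₁ h₂ h₁, HasAsdimLE.of_coarse m₁ m₂ h₁ h₂⟩
  simp only [metricAsdim, this]

theorem wordMetric_left_invariant {G : Type u} [AddGroup G] (S : Set G)
    (hS : AddSubgroup.closure S = ⊤) (g x y : G) :
    (wordMetric S hS).dist (g + x) (g + y) = (wordMetric S hS).dist x y := by
  change (wordNorm S (-(g + x) + (g + y)) : ℝ) = wordNorm S (-x + y)
  simp [add_assoc]

theorem wordMetric_ball_finite {G : Type u} [AddGroup G] (S : Set G) (hf : S.Finite)
    (hS : AddSubgroup.closure S = ⊤) (r : ℝ) :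
    {x : G | (wordMetric S hS).dist 0 x ≤ r}.Finite := by
  have hT : (S ∪ -S).Finite := hf.union hf.neg
  have : Finite ↥(S ∪ -S) := hT
  refine ((List.finite_length_le ↥(S ∪ -S) ⌊r⌋₊).image
    (fun l => (l.map Subtype.val).sum)).subset ?_
  intro x hx
  have hx' : ((wordNorm S (-0 + x) : ℕ) : ℝ) ≤ r := hx
  rw [neg_zero, zero_add] at hx'
  obtain ⟨l, hl, hsum, hlen⟩ := exists_word_length_eq hS x
  refine ⟨l.attach.map (fun a => ⟨a.1, by simpa using hl a.1 a.2⟩), ?_, ?_⟩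
  · simpa [hlen] using Nat.le_floor hx'
  · simpa [Function.comp_def] using hsum

/-- The asymptotic dimension of a finitely generated group can be computed with any left invariant
metric for which all balls are finite. -/
theorem fgAsdim_eq_of_proper {F : Type u} [AddGroup F] (h : AddGroup.FG F) (m : MetricSpace F)
    (hl : ∀ g x y : F, m.dist (g + x) (g + y) = m.dist x y)
    (hp : ∀ r : ℝ, {x : F | m.dist 0 x ≤ r}.Finite) :
    fgAsdim F h = @metricAsdim F m :=
  metricAsdim_eq_of_proper _ _ (wordMetric_left_invariant _ _)
    (wordMetric_ball_finite _ (Finset.finite_toSet _) _) hl hp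

/-- The asymptotic dimension of a finitely generated group can be computed with the word metric of
any finite generating set. -/
theorem fgAsdim_eq_of_closure {F : Type u} [AddGroup F] (h : AddGroup.FG F) (S : Set F)
    (hf : S.Finite) (hS : AddSubgroup.closure S = ⊤) :
    fgAsdim F h = @metricAsdim F (wordMetric S hS) :=
  fgAsdim_eq_of_proper h _ (wordMetric_left_invariant S hS) (wordMetric_ball_finite S hf hS)

end AsymptoticDimension

end

/-!
The asymptotic dimension of an abelian group `A` is its torsion-free rank, that is, the image of
`Module.rank ℤ A` in `ℕ∞` (`asdim_eq_rank`). The theorem then is the rank-nullity theorem for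
`ℤ`-modules.

For finitely generated `F` the claim is `fgAsdim_eq_finrank`. A homomorphism with finite kernel is
a coarse embedding, so asymptotic dimension cannot decrease along it (`HasAsdimLE.of_finite_ker`).
If `F` has rank `n`, then `F` modulo torsion is `ℤⁿ`, which gives `F → ℤⁿ` with finite kernel, and
a basis of a free subgroup of rank `k + 1 ≤ n` gives an injection `ℤᵏ⁺¹ → F`. What is left is that
`ℤⁿ` has asymptotic dimension at most `n` (`hasAsdimLE_int_pi`), and that `ℤᵏ⁺¹` does not have
asymptotic dimension at most `k` (`not_hasAsdimLE_int_pi`).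

The latter is of topological nature. Given `k + 1` families, one for each coordinate, let `A i` be
the union of the `i`-th lower face of a large cube and of the members of the `i`-th family which
come close to that face. As the members are bounded, `A i` stays away from the opposite face. By a
discrete Poincaré–Miranda theorem (`exists_unit_cube`) there is a unit cube which, for every `i`,
meets the boundary of a neighbourhood of `A i`; its points lie in no member of any family.

The discrete Poincaré–Miranda theorem is proved with mod 2 cochains on the cubical lattice: if
`f i` is `0` on the `i`-th lower face and `1` on the `i`-th upper face, then the cup product of the
coboundaries `δ (f i)` has integral `1` over the cube (`sum_cup_eq_one`), by induction on the
dimension: this cup product is closed (`sum_cup_erase_eq_zero`), so that one can integrate by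
parts, and the boundary terms are known. Thus the cup product is nonzero on some unit cube, on
which no `f i` can be constant.
-/

namespace AsymptoticDimension

open Finset Function

/-! ### Cup products of coboundaries on the cubical lattice, mod 2 -/

section CupProduct

variable {ι : Type*} [DecidableEq ι]

/-- The neighbour `x + e_j` of the lattice point `x`. -/
def stepAt (j : ι) (x : ι → ℕ) : ι → ℕ := update x j (x j + 1)

theorem stepAt_comm (i j : ι) (x : ι → ℕ) : stepAt i (stepAt j x) = stepAt j (stepAt i x) := by
  by_cases h : i = j
  · rw [h]
  · simp only [stepAt, update_of_ne h, update_of_ne (Ne.symm h)]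
    exact update_comm (Ne.symm h) _ _ _

theorem stepAt_of_ne {i j : ι} (h : i ≠ j) (x : ι → ℕ) : stepAt j x i = x i := update_of_ne h _ _

/-- The value of the mod 2 cup product `δ f_{i₁} ∪ ⋯ ∪ δ f_{iₖ}`, for `[i₁, …, iₖ] = l`, on the
lattice cube with least vertex `x` and set of directions `J`. (It is meaningful if `J` has `k`
elements, but the recursion makes sense, and is used, without this restriction.) -/
def cup (f : ι → (ι → ℕ) → ZMod 2) : List ι → Finset ι → (ι → ℕ) → ZMod 2
  | [], _, _ => 1
  | i :: l, J, x => ∑ j ∈ J, (f i (stepAt j x) + f i x) * cup f l (J.erase j) (stepAt j x)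

/-- In characteristic two, a sum of a symmetric function over the ordered pairs of different
elements vanishes. -/
theorem sum_offDiag_eq_zero (D : Finset ι) (F : ι → ι → ZMod 2) (hF : ∀ i j, F i j = F j i) :
    ∑ i ∈ D, ∑ j ∈ D.erase i, F i j = 0 := by
  rw [Finset.sum_sigma' D (fun i => D.erase i)]
  refine Finset.sum_involution (fun p _ => ⟨p.2, p.1⟩) ?_ ?_ ?_ ?_
  · intro p _
    simp only [hF p.2 p.1, CharTwo.add_self_eq_zero]
  · intro p hp _ h
    simp only [mem_sigma, mem_erase] at hp
    exact hp.2.1 (congrArg Sigma.fst h)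
  · intro p hp
    simp only [mem_sigma, mem_erase] at hp ⊢
    exact ⟨hp.2.2, Ne.symm hp.2.1, hp.1⟩
  · intro p _
    rfl

/-- The cup product of coboundaries is a cocycle. -/
theorem sum_cup_erase_eq_zero (f : ι → (ι → ℕ) → ZMod 2) (l : List ι) :
    ∀ (D : Finset ι) (x : ι → ℕ),
      ∑ j ∈ D, (cup f l (D.erase j) (stepAt j x) + cup f l (D.erase j) x) = 0 := by
  induction l with
  | nil =>
    intro D x
    simp only [cup, CharTwo.add_self_eq_zero, Finset.sum_const_zero]
  | cons k l ih =>
    intro D x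
    set w : ι → ι → (ι → ℕ) → ZMod 2 := fun i j => cup f l ((D.erase i).erase j) with hw
    have hsymm : ∀ i j, w i j = w j i := fun i j => by simp only [hw, Finset.erase_right_comm]
    have hih : ∀ i, ∑ j ∈ D.erase i, (w i j (stepAt j (stepAt i x)) + w i j (stepAt i x)) = 0 :=
      fun i => ih (D.erase i) (stepAt i x)
    -- Each of these sums vanishes by symmetry, or by the induction hypothesis at `stepAt i x`;
    -- the sum in question is, term by term, the sum of all six.
    have s₁ : ∑ i ∈ D, ∑ j ∈ D.erase i,
        f k (stepAt j (stepAt i x)) * w i j (stepAt j (stepAt i x)) = 0 :=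
      sum_offDiag_eq_zero D _ fun i j => by rw [stepAt_comm, hsymm]
    have s₂ : ∑ i ∈ D, ∑ j ∈ D.erase i, f k x * w i j (stepAt j (stepAt i x)) = 0 :=
      sum_offDiag_eq_zero D _ fun i j => by rw [stepAt_comm, hsymm]
    have s₃ : ∑ i ∈ D, ∑ j ∈ D.erase i,
        f k (stepAt i x) * (w i j (stepAt j (stepAt i x)) + w i j (stepAt i x)) = 0 :=
      Finset.sum_eq_zero fun i _ => by rw [← Finset.mul_sum, hih, mul_zero]
    have s₄ : ∑ i ∈ D, ∑ j ∈ D.erase i,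
        f k x * (w i j (stepAt j (stepAt i x)) + w i j (stepAt i x)) = 0 :=
      Finset.sum_eq_zero fun i _ => by rw [← Finset.mul_sum, hih, mul_zero]
    have s₅ : ∑ i ∈ D, ∑ j ∈ D.erase i,
        (f k (stepAt j x) * w i j (stepAt j x) + f k (stepAt i x) * w i j (stepAt i x)) = 0 :=
      sum_offDiag_eq_zero D _ fun i j => by rw [hsymm, add_comm]
    have s₆ : ∑ i ∈ D, ∑ j ∈ D.erase i,
        (f k x * w i j (stepAt j x) + f k x * w i j (stepAt i x)) = 0 :=
      sum_offDiag_eq_zero D _ fun i j => by rw [hsymm, add_comm]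
    have key := congrArg₂ (· + ·) (congrArg₂ (· + ·) (congrArg₂ (· + ·) s₁ s₂)
      (congrArg₂ (· + ·) s₃ s₄)) (congrArg₂ (· + ·) s₅ s₆)
    simp only [← Finset.sum_add_distrib, add_zero] at key
    refine Eq.trans (Finset.sum_congr rfl fun i _ => ?_) key
    rw [cup, cup, ← Finset.sum_add_distrib]
    refine Finset.sum_congr rfl fun j _ => ?_
    change (_ + _) * w i j _ + (_ + _) * w i j _ = _
    have h₂ : (2 : ZMod 2) = 0 := rfl
    linear_combination (- f k (stepAt i x) * w i j (stepAt i x)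
      - f k x * w i j (stepAt j (stepAt i x)) - f k x * w i j (stepAt i x)) * h₂

/-! ### The discrete Poincaré–Miranda theorem -/

/-- The lattice points of the cube with `J` as its set of directions and side length `N`, in the
affine subspace through `x`. -/
def gridBox [Fintype ι] (N : ℕ) (J : Finset ι) (x : ι → ℕ) : Finset (ι → ℕ) :=
  Fintype.piFinset fun i => if i ∈ J then range N else {x i}

theorem mem_gridBox [Fintype ι] {N : ℕ} {J : Finset ι} {x y : ι → ℕ} :
    y ∈ gridBox N J x ↔ ∀ i, (i ∈ J → y i < N) ∧ (i ∉ J → y i = x i) := by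
  simp only [gridBox, Fintype.mem_piFinset]
  refine forall_congr' fun i => ?_
  by_cases h : i ∈ J <;> simp [h]

theorem sum_gridBox [Fintype ι] {N : ℕ} {J : Finset ι} {j : ι} (hj : j ∈ J) (x : ι → ℕ)
    (F : (ι → ℕ) → ZMod 2) :
    ∑ y ∈ gridBox N J x, F y =
      ∑ y ∈ gridBox N (J.erase j) x, ∑ t ∈ range N, F (update y j t) := by
  rw [← Finset.sum_product']
  refine Finset.sum_bij' (fun y _ => (update y j (x j), y j)) (fun p _ => update p.1 j p.2)
    ?_ ?_ ?_ ?_ ?_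
  · intro y hy
    rw [mem_gridBox] at hy
    rw [mem_product, mem_gridBox, mem_range]
    refine ⟨fun i => ?_, (hy j).1 hj⟩
    by_cases h : i = j
    · subst h; simp
    · simpa [h] using hy i
  · rintro ⟨y, t⟩ hy
    rw [mem_product, mem_gridBox, mem_range] at hy
    rw [mem_gridBox]
    intro i
    by_cases h : i = j
    · subst h; simpa [hj] using hy.2
    · simpa [h] using hy.1 i
  · intro y _
    simp
  · rintro ⟨y, t⟩ hy
    rw [mem_product, mem_gridBox] at hy
    have := (hy.1 j).2 (by simp)
    simp [← this]
  · intro y _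
    simp

/-- The fundamental theorem of calculus in the direction `j`, mod 2. -/
theorem sum_gridBox_stepAt [Fintype ι] {N : ℕ} {J : Finset ι} {j : ι} (hj : j ∈ J) (x : ι → ℕ)
    (F : (ι → ℕ) → ZMod 2) :
    ∑ y ∈ gridBox N J x, (F (stepAt j y) + F y) =
      ∑ y ∈ gridBox N (J.erase j) x, (F (update y j N) + F (update y j 0)) := by
  rw [sum_gridBox hj]
  refine Finset.sum_congr rfl fun y _ => ?_
  have := Finset.sum_range_sub (fun t => F (update y j t)) N
  simp only [CharTwo.sub_eq_add] at this
  rw [← this]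
  simp [stepAt]

/-- On a face orthogonal to the direction `j` the function `f j` is constant, so a cup product which
contains `δ (f j)` vanishes there. -/
theorem cup_eq_zero_of_face {f : ι → (ι → ℕ) → ZMod 2} {N : ℕ} (h₀ : ∀ i x, x i = 0 → f i x = 0)
    (h₁ : ∀ i x, x i = N → f i x = 1) {l : List ι} {j : ι} (hj : j ∈ l) :
    ∀ {J : Finset ι} {x : ι → ℕ}, j ∉ J → x j = 0 ∨ x j = N → cup f l J x = 0 := by
  induction l with
  | nil => simp at hj
  | cons k l ih =>
    intro J x hJ hx
    refine Finset.sum_eq_zero fun a ha => ?_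
    have hne : j ≠ a := fun h => hJ (h ▸ ha)
    have hs := stepAt_of_ne hne x
    rcases List.mem_cons.1 hj with rfl | hj
    · rcases hx with hx | hx
      · rw [h₀ _ _ hx, h₀ _ _ (hs.trans hx), add_zero, zero_mul]
      · rw [h₁ _ _ hx, h₁ _ _ (hs.trans hx), CharTwo.add_self_eq_zero, zero_mul]
    · rw [ih hj (fun h => hJ (mem_of_mem_erase h)) (by rwa [hs]), mul_zero]

/-- If `f i` is `0` on the `i`-th lower face and `1` on the `i`-th upper face of the cube, then the
integral over the cube of the cup product of the coboundaries of the `f i` is `1`. -/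
theorem sum_cup_eq_one [Fintype ι] {f : ι → (ι → ℕ) → ZMod 2} {N : ℕ} (h₀ : ∀ i x, x i = 0 → f i x = 0)
    (h₁ : ∀ i x, x i = N → f i x = 1) {l : List ι} (hl : l.Nodup) (x : ι → ℕ) :
    ∑ y ∈ gridBox N l.toFinset x, cup f l l.toFinset y = 1 := by
  induction l generalizing x with
  | nil =>
    have : gridBox N (∅ : Finset ι) x = {x} := by
      ext y
      simp [mem_gridBox, funext_iff]
    simp [cup, this]
  | cons i l ih =>
    obtain ⟨hi, hl⟩ := List.nodup_cons.1 hl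
    set J := (i :: l).toFinset with hJ
    have hiJ : i ∈ J := by simp [hJ]
    have hJi : J.erase i = l.toFinset := by
      rw [hJ, List.toFinset_cons, Finset.erase_insert (by simpa using hi)]
    -- Summation by parts; the remaining term is zero since the cup product is closed.
    have parts : ∀ y, cup f (i :: l) J y = ∑ j ∈ J,
        (f i (stepAt j y) * cup f l (J.erase j) (stepAt j y) +
          f i y * cup f l (J.erase j) y) := by
      intro y
      have hc : ∑ j ∈ J, f i y * (cup f l (J.erase j) (stepAt j y) + cup f l (J.erase j) y) = 0 := by
        rw [← Finset.mul_sum, sum_cup_erase_eq_zero, mul_zero]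
      rw [← add_zero (cup f (i :: l) J y), ← hc, cup, ← Finset.sum_add_distrib]
      refine Finset.sum_congr rfl fun j _ => ?_
      linear_combination CharTwo.add_self_eq_zero (f i y * cup f l (J.erase j) (stepAt j y))
    simp only [parts]
    rw [Finset.sum_comm, Finset.sum_eq_single_of_mem i hiJ]
    · rw [sum_gridBox_stepAt hiJ x (fun y => f i y * cup f l (J.erase i) y), hJi,
        ← ih hl (update x i N)]
      refine Finset.sum_bij' (fun y _ => update y i N) (fun y _ => update y i (x i)) ?_ ?_ ?_ ?_ ?_
      · intro y hy
        rw [mem_gridBox] at hy ⊢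
        intro a
        by_cases h : a = i
        · subst h; simp [hi]
        · simpa [h] using hy a
      · intro y hy
        rw [mem_gridBox] at hy ⊢
        intro a
        by_cases h : a = i
        · subst h; simp [hi]
        · simpa [h] using hy a
      · intro y hy
        have := (mem_gridBox.1 hy i).2 (by simpa using hi)
        simp [← this]
      · intro y hy
        have := (mem_gridBox.1 hy i).2 (by simpa using hi)
        rw [update_self] at this
        simp [← this]
      · intro y _
        rw [h₁ i (update y i N) (by simp), h₀ i (update y i 0) (by simp), one_mul, zero_mul,
          add_zero]
    · intro j hj hne
      rw [sum_gridBox_stepAt hj x (fun y => f i y * cup f l (J.erase j) y)]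
      refine Finset.sum_eq_zero fun y _ => ?_
      have hjl : j ∈ l := by
        simpa [hJ, hne] using hj
      rw [cup_eq_zero_of_face h₀ h₁ hjl (by simp) (by simp),
        cup_eq_zero_of_face h₀ h₁ hjl (by simp) (by simp)]
      simp

theorem exists_ne_of_cup_ne_zero {f : ι → (ι → ℕ) → ZMod 2} {l : List ι} {i : ι} (hi : i ∈ l) :
    ∀ {J : Finset ι} {x : ι → ℕ}, cup f l J x ≠ 0 →
      ∃ y z : ι → ℕ, (∀ j, x j ≤ y j ∧ y j ≤ if j ∈ J then x j + 1 else x j) ∧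
        (∀ j, x j ≤ z j ∧ z j ≤ if j ∈ J then x j + 1 else x j) ∧ f i y ≠ f i z := by
  induction l with
  | nil => simp at hi
  | cons k l ih =>
    intro J x h
    obtain ⟨a, ha, hne⟩ := Finset.exists_ne_zero_of_sum_ne_zero h
    have hx : ∀ j, x j ≤ stepAt a x j ∧ stepAt a x j ≤ if j ∈ J then x j + 1 else x j := by
      intro j
      by_cases hja : j = a
      · subst hja; simp [stepAt, ha]
      · rw [stepAt_of_ne hja]; split_ifs <;> omega
    rcases List.mem_cons.1 hi with rfl | hi
    · refine ⟨stepAt a x, x, hx, fun j => ⟨le_rfl, by split_ifs <;> omega⟩, fun heq => ?_⟩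
      exact left_ne_zero_of_mul hne (by rw [heq, CharTwo.add_self_eq_zero])
    · obtain ⟨y, z, hy, hz, hyz⟩ := ih hi (right_ne_zero_of_mul hne)
      have widen : ∀ j m : _, (stepAt a x j ≤ m ∧
          m ≤ if j ∈ J.erase a then stepAt a x j + 1 else stepAt a x j) →
          x j ≤ m ∧ m ≤ if j ∈ J then x j + 1 else x j := by
        intro j m hm
        by_cases hja : j = a
        · subst hja
          simp only [stepAt, update_self, mem_erase, ne_eq, not_true, false_and, if_false] at hm
          simp only [ha, if_true]
          omega
        · simpa [hja, stepAt_of_ne hja] using hm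
      exact ⟨y, z, fun j => widen j _ (hy j), fun j => widen j _ (hz j), hyz⟩

/-- The discrete Poincaré–Miranda theorem: if `P i` fails on the `i`-th lower face and holds on the
`i`-th upper face of the cube of side length `N`, then there is a unit cube on which no `P i` is
constant. -/
theorem exists_unit_cube [Fintype ι] (N : ℕ) (P : ι → (ι → ℕ) → Prop) (h₀ : ∀ i x, x i = 0 → ¬ P i x)
    (h₁ : ∀ i x, x i = N → P i x) :
    ∃ x : ι → ℕ, (∀ i, x i < N) ∧ ∀ i, ∃ y z : ι → ℕ, (∀ j, x j ≤ y j ∧ y j ≤ x j + 1) ∧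
      (∀ j, x j ≤ z j ∧ z j ≤ x j + 1) ∧ P i y ∧ ¬ P i z := by
  classical
  set f : ι → (ι → ℕ) → ZMod 2 := fun i x => if P i x then 1 else 0 with hf
  have hs := sum_cup_eq_one (f := f) (N := N) (fun i x h => if_neg (h₀ i x h))
    (fun i x h => if_pos (h₁ i x h)) (Finset.nodup_toList (univ : Finset ι)) 0
  obtain ⟨x, hx, hne⟩ := Finset.exists_ne_zero_of_sum_ne_zero (hs ▸ one_ne_zero)
  refine ⟨x, fun i => (mem_gridBox.1 hx i).1 (by simp), fun i => ?_⟩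
  obtain ⟨y, z, hy, hz, h⟩ := exists_ne_of_cup_ne_zero (i := i) (by simp) hne
  simp only [Finset.toList_toFinset, Finset.mem_univ, if_true] at hy hz
  by_cases hPy : P i y
  · refine ⟨y, z, hy, hz, hPy, fun hPz => h ?_⟩
    simp [hf, hPy, hPz]
  · refine ⟨z, y, hz, hy, by_contra fun hPz => h ?_, hPy⟩
    simp [hf, hPy, hPz]

end CupProduct
/-! ### The asymptotic dimension of `ℤⁿ` -/

theorem lt_dist_of_coord {n : ℕ} {x y : Fin n → ℤ} {g : ℕ} {d : ℝ} (hg : d < g) (i : Fin n)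
    (h : (g : ℤ) ≤ |x i - y i|) : d < dist x y := by
  refine lt_of_lt_of_le ?_ (dist_le_pi_dist x y i)
  rw [Int.dist_eq]
  have : (g : ℝ) ≤ |(x i : ℝ) - y i| := by exact_mod_cast h
  linarith

/-- For each `j` the set of all `x` with no `⌊xᵢ / g⌋` congruent to `j` mod `n + 1` is a
disjoint union of cubes at distance `g` from each other. These sets cover `ℤⁿ`, since the `n`
coordinates cannot exclude all `n + 1` values of `j`. -/
theorem hasAsdimLE_int_pi (n : ℕ) : HasAsdimLE (Fin n → ℤ) n := by
  intro d hd
  obtain ⟨g, hg⟩ := exists_nat_gt d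
  have hg0 : (0 : ℤ) < g := by
    have : (0 : ℝ) < g := hd.trans hg
    exact_mod_cast this
  set q : Fin (n + 1) → ℤ → ℤ := fun j t => t / g - (j : ℕ) with hq
  refine ⟨(g * (n + 1) : ℕ), fun j => Set.range fun c : Fin n → ℤ =>
    {x | ∀ i, ¬ ((n : ℤ) + 1 ∣ q j (x i)) ∧ q j (x i) / ((n : ℤ) + 1) = c i}, ?_, ?_, ?_⟩
  · rintro j _ ⟨c, rfl⟩ _ ⟨c', rfl⟩ hne x hx y hy
    obtain ⟨i, hi⟩ : ∃ i, c i ≠ c' i := by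
      by_contra! h
      exact hne (by rw [funext h])
    refine lt_dist_of_coord hg i ?_
    have key : ∀ s t : ℤ, ¬ ((n : ℤ) + 1 ∣ q j t) →
        q j s / ((n : ℤ) + 1) < q j t / ((n : ℤ) + 1) → (g : ℤ) ≤ t - s := by
      intro s t hdvd hlt
      have hn : (0 : ℤ) < (n : ℤ) + 1 := by positivity
      -- A multiple of `n + 1` lies above `q j s` and strictly below `q j t`.
      have h₁ : q j s < (q j t / ((n : ℤ) + 1)) * ((n : ℤ) + 1) :=
        (Int.ediv_lt_iff_lt_mul hn).1 hlt
      have h₂ : (q j t / ((n : ℤ) + 1)) * ((n : ℤ) + 1) < q j t :=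
        lt_of_le_of_ne (Int.ediv_mul_le _ hn.ne') fun h => hdvd ⟨_, by rw [← h]; ring⟩
      have h₃ : s / g + 2 ≤ t / g := by simp only [hq] at h₁ h₂; omega
      have h₄ := Int.lt_ediv_add_one_mul_self s hg0
      have h₅ := Int.ediv_mul_le t hg0.ne'
      nlinarith
    rcases lt_or_gt_of_ne hi with h | h
    · rw [abs_sub_comm]
      exact (key _ _ (hy i).1 (by rw [(hx i).2, (hy i).2]; exact h)).trans (le_abs_self _)
    · exact (key _ _ (hx i).1 (by rw [(hx i).2, (hy i).2]; exact h)).trans (le_abs_self _)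
  · rintro j _ ⟨c, rfl⟩ x hx y hy
    rw [dist_pi_le_iff (by positivity)]
    intro i
    have key : ∀ s t : ℤ, q j s / ((n : ℤ) + 1) = q j t / ((n : ℤ) + 1) →
        s - t ≤ g * (n + 1) := by
      intro s t h
      have hn : (0 : ℤ) < (n : ℤ) + 1 := by positivity
      have h₁ := Int.lt_ediv_add_one_mul_self (q j s) hn
      have h₂ := Int.ediv_mul_le (q j t) hn.ne'
      rw [h] at h₁
      have h₃ : s / g ≤ t / g + n := by simp only [hq] at h₁ h₂; linarith
      have h₄ := Int.lt_ediv_add_one_mul_self s hg0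
      have h₅ := Int.ediv_mul_le t hg0.ne'
      nlinarith
    rw [Int.dist_eq, abs_le]
    have e : q j (x i) / ((n : ℤ) + 1) = q j (y i) / ((n : ℤ) + 1) := by rw [(hx i).2, (hy i).2]
    have h₁ : ((x i - y i : ℤ) : ℝ) ≤ ((g * (n + 1) : ℤ) : ℝ) := by exact_mod_cast key _ _ e
    have h₂ : ((y i - x i : ℤ) : ℝ) ≤ ((g * (n + 1) : ℤ) : ℝ) := by exact_mod_cast key _ _ e.symm
    push_cast at h₁ h₂ ⊢
    constructor <;> linarith
  · intro x
    have hn : (0 : ℤ) < (n : ℤ) + 1 := by positivity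
    -- Each coordinate excludes a single `j`.
    obtain ⟨j, hj⟩ : ∃ j : Fin (n + 1), ∀ i, ((x i / g) % ((n : ℤ) + 1)) ≠ (j : ℕ) := by
      by_contra! h
      choose b hb using h
      have hinj : Injective b := fun j k hjk => by
        have := hb j
        rw [hjk, hb k] at this
        exact Fin.ext (by exact_mod_cast this.symm)
      simpa using Fintype.card_le_of_injective b hinj
    refine ⟨j, _, ⟨fun i => q j (x i) / ((n : ℤ) + 1), rfl⟩, fun i => ⟨fun hdvd => hj i ?_, rfl⟩⟩
    rw [Int.emod_eq_emod_iff_emod_sub_eq_zero.2 (Int.emod_eq_zero_of_dvd hdvd)]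
    exact Int.emod_eq_of_lt (by positivity) (by exact_mod_cast j.2)

theorem not_hasAsdimLE_int_pi (n : ℕ) : ¬ HasAsdimLE (Fin (n + 1) → ℤ) n := by
  intro h
  obtain ⟨R, 𝒰, hd, hb, hc⟩ := h 4 (by norm_num)
  obtain ⟨M, hM⟩ := exists_nat_gt R
  set cst : (Fin (n + 1) → ℕ) → Fin (n + 1) → ℤ := fun x i => x i with hcst
  -- The union of the lower half-space and of all members of `𝒰 i` which come within `4` of it. The
  -- cube has side `M + 7`, since `A i` lies below height `M + 4` and its 2-neighbourhood has to miss
  -- the upper face. A unit cube meeting both that neighbourhood and its complement has its points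
  -- outside `A i`, but within `3 < 4` of it.
  set A : Fin (n + 1) → Set (Fin (n + 1) → ℤ) := fun i =>
    {x | x i ≤ 0 ∨ ∃ U ∈ 𝒰 i, x ∈ U ∧ ∃ y ∈ U, y i ≤ 4} with hA
  have h₀ : ∀ i x, x i = 0 → ¬ ∀ a ∈ A i, 2 < dist (cst x) a := by
    intro i x hx hP
    have := hP (cst x) (Or.inl (by simp [hcst, hx]))
    rw [dist_self] at this
    linarith
  have h₁ : ∀ i x, x i = M + 7 → ∀ a ∈ A i, 2 < dist (cst x) a := by
    intro i x hx a ha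
    have hai : (a i : ℝ) ≤ M + 4 := by
      rcases ha with ha | ⟨U, hU, haU, b, hbU, hb4⟩
      · have : (a i : ℝ) ≤ 0 := by exact_mod_cast ha
        have : (0 : ℝ) ≤ M := by positivity
        linarith
      · have h₁ := (dist_le_pi_dist a b i).trans (hb i U hU a haU b hbU)
        rw [Int.dist_eq, abs_le] at h₁
        have : (b i : ℝ) ≤ 4 := by exact_mod_cast hb4
        linarith
    refine lt_of_lt_of_le ?_ (dist_le_pi_dist (cst x) a i)
    rw [Int.dist_eq]
    refine lt_of_lt_of_le ?_ (le_abs_self _)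
    simp only [hcst, hx]
    push_cast
    linarith
  obtain ⟨x, -, hx⟩ := exists_unit_cube (M + 7) _ h₀ h₁
  obtain ⟨i, U, hU, hxU⟩ := hc (cst x)
  obtain ⟨y, z, hy, hz, hPy, hPz⟩ := hx i
  push Not at hPz
  obtain ⟨a, ha, hza⟩ := hPz
  have close : ∀ w : Fin (n + 1) → ℕ, (∀ j, x j ≤ w j ∧ w j ≤ x j + 1) →
      dist (cst x) (cst w) ≤ 1 := by
    intro w hw
    rw [dist_pi_le_iff zero_le_one]
    intro j
    obtain ⟨h₁, h₂⟩ := hw j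
    rw [Int.dist_eq, abs_le]
    have h₃ : (x j : ℝ) ≤ w j := by exact_mod_cast h₁
    have h₄ : (w j : ℝ) ≤ x j + 1 := by exact_mod_cast h₂
    simp only [hcst, Int.cast_natCast]
    constructor <;> linarith
  have hxa : dist (cst x) a ≤ 3 := by
    linarith [dist_triangle (cst x) (cst z) a, close z hz]
  have hxA : cst x ∉ A i := fun hxA => by
    linarith [hPy _ hxA, dist_comm (cst x) (cst y), close y hy]
  rcases ha with ha | ⟨V, hV, haV, b, hbV, hb4⟩
  -- If `a` lies below the lower face, then `x` itself, hence `U`, is close to that face.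
  · refine hxA (Or.inr ⟨U, hU, hxU, _, hxU, ?_⟩)
    have h₁ := (dist_le_pi_dist (cst x) a i).trans hxa
    rw [Int.dist_eq, abs_le] at h₁
    have h₂ : (cst x i : ℝ) ≤ 4 := by
      have : (a i : ℝ) ≤ 0 := by exact_mod_cast ha
      linarith
    exact_mod_cast h₂
  · by_cases hUV : U = V
    · subst hUV
      exact hxA (Or.inr ⟨U, hU, hxU, b, hbV, hb4⟩)
    · linarith [hd i U hU V hV hUV _ hxU _ haV]

/-! ### Homomorphisms with finite kernel -/

theorem HasAsdimLE.of_coarse_embedding {X : Type*} {Y : Type*} (mX : MetricSpace X)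
    (mY : MetricSpace Y) (f : X → Y) {n : ℕ}
    (h₁ : ∀ r : ℝ, ∃ s : ℝ, ∀ x y : X, mX.dist x y ≤ r → mY.dist (f x) (f y) ≤ s)
    (h₂ : ∀ r : ℝ, ∃ s : ℝ, ∀ x y : X, mY.dist (f x) (f y) ≤ r → mX.dist x y ≤ s)
    (h : HasAsdimLE Y n) : HasAsdimLE X n := by
  intro d _
  obtain ⟨s, hs⟩ := h₁ d
  obtain ⟨R, 𝒰, hd, hb, hc⟩ := h (max s 1) (lt_max_of_lt_right one_pos)
  obtain ⟨R', hR'⟩ := h₂ R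
  refine ⟨R', fun i => (fun U => f ⁻¹' U) '' 𝒰 i, ?_, ?_, ?_⟩
  · rintro i _ ⟨U, hU, rfl⟩ _ ⟨V, hV, rfl⟩ hUV x hx y hy
    by_contra hle
    have hne : U ≠ V := fun h => hUV (by rw [h])
    exact absurd ((hs x y (not_lt.1 hle)).trans (le_max_left s 1))
      (not_le.2 (hd i U hU V hV hne _ hx _ hy))
  · rintro i _ ⟨U, hU, rfl⟩ x hx y hy
    exact hR' x y (hb i U hU _ hx _ hy)
  · intro x
    obtain ⟨i, U, hU, hx⟩ := hc (f x)
    exact ⟨i, _, ⟨U, hU, rfl⟩, hx⟩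

/-- A homomorphism with finite kernel between groups with proper left invariant metrics is a
coarse embedding. -/
theorem HasAsdimLE.of_finite_ker {G : Type*} {H : Type*} [AddGroup G] [AddGroup H]
    (mG : MetricSpace G) (mH : MetricSpace H)
    (hlG : ∀ g x y : G, mG.dist (g + x) (g + y) = mG.dist x y)
    (hpG : ∀ r : ℝ, {x : G | mG.dist 0 x ≤ r}.Finite)
    (hlH : ∀ g x y : H, mH.dist (g + x) (g + y) = mH.dist x y)
    (hpH : ∀ r : ℝ, {x : H | mH.dist 0 x ≤ r}.Finite)
    (f : G →+ H) (hf : (f.ker : Set G).Finite) {n : ℕ} (h : HasAsdimLE H n) : HasAsdimLE G n := by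
  have eG : ∀ x y, mG.dist x y = mG.dist 0 (-x + y) := fun x y => by
    rw [← hlG (-x) x y, neg_add_cancel]
  have eH : ∀ x y, mH.dist (f x) (f y) = mH.dist 0 (f (-x + y)) := fun x y => by
    rw [← hlH (-f x) (f x) (f y), neg_add_cancel, map_add, map_neg]
  refine h.of_coarse_embedding mG mH f (fun r => ?_) (fun r => ?_)
  · obtain ⟨s, hs⟩ := ((hpG r).image (fun x => mH.dist 0 (f x))).bddAbove
    exact ⟨s, fun x y hxy => (eH x y).trans_le (hs ⟨-x + y, (eG x y).symm.trans_le hxy, rfl⟩)⟩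
  · have hfin : (f ⁻¹' {x : H | mH.dist 0 x ≤ r}).Finite := by
      refine (hpH r).preimage' fun b _ => ?_
      rcases (f ⁻¹' {b}).eq_empty_or_nonempty with he | ⟨a, ha⟩
      · rw [he]; exact Set.finite_empty
      · refine (hf.image (fun k => a + k)).subset fun x hx => ⟨-a + x, ?_, by simp⟩
        have h₁ : f a = b := ha
        have h₂ : f x = b := hx
        simp [AddMonoidHom.mem_ker, h₁, h₂]
    obtain ⟨s, hs⟩ := (hfin.image (fun x => mG.dist 0 x)).bddAbove
    exact ⟨s, fun x y hxy => (eG x y).trans_le (hs ⟨-x + y, (eH x y).symm.trans_le hxy, rfl⟩)⟩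

theorem int_pi_left_invariant (n : ℕ) (g x y : Fin n → ℤ) : dist (g + x) (g + y) = dist x y :=
  dist_add_left g x y

theorem int_pi_ball_finite (n : ℕ) (r : ℝ) : {x : Fin n → ℤ | dist 0 x ≤ r}.Finite := by
  have : {x : Fin n → ℤ | dist 0 x ≤ r} = Metric.closedBall 0 r := by
    ext x; simp [dist_comm]
  rw [this]
  exact (isCompact_closedBall _ _).finite_of_discrete

/-! ### Finitely generated abelian groups -/

theorem exists_finite_ker_to_int_pi (F : Type*) [AddCommGroup F] [Module.Finite ℤ F] :
    ∃ f : F →+ (Fin (Module.finrank ℤ F) → ℤ), (f.ker : Set F).Finite := by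
  set T := Submodule.torsion ℤ F with hT
  have hr : Module.finrank ℤ (F ⧸ T) = Module.finrank ℤ F :=
    finrank_quotient_eq_of_le_torsion le_rfl
  have : Finite T := Module.finite_of_fg_torsion T (Submodule.torsion_isTorsion)
  have e := (Module.finBasisOfFinrankEq ℤ (F ⧸ T) hr).equivFun
  refine ⟨(e.toLinearMap ∘ₗ T.mkQ).toAddMonoidHom, (Set.toFinite (T : Set F)).subset fun x hx => ?_⟩
  have : e (T.mkQ x) = 0 := hx
  simpa using this

theorem metricAsdim_eq {X : Type*} [MetricSpace X] {n : ℕ} (h : HasAsdimLE X n)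
    (h' : ∀ k, HasAsdimLE X k → n ≤ k) : metricAsdim X = n := by
  refine le_antisymm (sInf_le ⟨n, rfl, h⟩) (le_sInf ?_)
  rintro _ ⟨k, rfl, hk⟩
  exact_mod_cast h' k hk

theorem fgAsdim_eq_finrank (F : Type*) [AddCommGroup F] (h : AddGroup.FG F) :
    fgAsdim F h = Module.finrank ℤ F := by
  have : Module.Finite ℤ F := Module.Finite.iff_addGroup_fg.2 h
  set S : Set F := (h.out.choose : Set F)
  have hS : AddSubgroup.closure S = ⊤ := h.out.choose_spec
  have hl := wordMetric_left_invariant S hS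
  have hp := wordMetric_ball_finite S (Finset.finite_toSet _) hS
  let _ := wordMetric S hS
  refine metricAsdim_eq ?_ fun k hk => ?_
  · obtain ⟨f, hf⟩ := exists_finite_ker_to_int_pi F
    exact HasAsdimLE.of_finite_ker _ _ hl hp (int_pi_left_invariant _) (int_pi_ball_finite _) f hf
      (hasAsdimLE_int_pi _)
  · by_contra! hlt
    obtain ⟨v, hv⟩ := exists_linearIndependent_of_le_finrank (R := ℤ) (M := F) hlt
    refine not_hasAsdimLE_int_pi k (HasAsdimLE.of_finite_ker _ _ (int_pi_left_invariant _)
      (int_pi_ball_finite _) hl hp (Fintype.linearCombination ℤ v).toAddMonoidHom ?_ hk)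
    refine (Set.finite_singleton 0).subset fun x hx => ?_
    exact hv.fintypeLinearCombination_injective (hx.trans (map_zero _).symm)

/-! ### Arbitrary abelian groups -/

/-- The asymptotic dimension of an abelian group is its torsion-free rank. -/
theorem asdim_eq_rank (A : Type*) [AddCommGroup A] :
    asdim A = Cardinal.toENat (Module.rank ℤ A) := by
  refine le_antisymm (iSup₂_le fun F hF => ?_) ?_
  · have : Module.Finite ℤ F := Module.Finite.iff_addGroup_fg.2 hF
    rw [fgAsdim_eq_finrank, Cardinal.natCast_le_toENat, Module.finrank_eq_rank]
    exact Submodule.rank_le (AddSubgroup.toIntSubmodule F)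
  · refine ENat.forall_natCast_le_iff_le.1 fun n hn => ?_
    have hn' : (n : Cardinal) ≤ Module.rank ℤ A := Cardinal.natCast_le_toENat.1 hn
    obtain ⟨v, hv⟩ := exists_linearIndependent_of_le_rank hn'
    set F : AddSubgroup A := (Submodule.span ℤ (Set.range v)).toAddSubgroup with hF
    have hfg : AddGroup.FG F :=
      Module.Finite.iff_addGroup_fg.1 (Module.Finite.span_of_finite ℤ (Set.finite_range v))
    refine le_trans ?_ (le_iSup₂_of_le F hfg le_rfl)
    rw [fgAsdim_eq_finrank]
    have : Module.finrank ℤ F = n := by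
      exact (finrank_span_eq_card hv).trans (Fintype.card_fin n)
    rw [this]

theorem asdim_eq_add_of_exact {B : Type*} {A : Type*} {C : Type*} [AddCommGroup B] [AddCommGroup A]
    [AddCommGroup C] (i : B →+ A) (p : A →+ C) (hi : Injective i) (hip : Exact i p)
    (hp : Surjective p) : asdim A = asdim B + asdim C := by
  have h := LinearMap.lift_rank_eq_of_surjective (f := p.toIntLinearMap) hp
  have hk : LinearMap.ker p.toIntLinearMap = LinearMap.range i.toIntLinearMap :=
    LinearMap.exact_iff.1 hip
  have hr' := (LinearEquiv.ofInjective i.toIntLinearMap hi).lift_rank_eq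
  rw [hk] at h
  have h' := congrArg Cardinal.toENat h
  have hr'' := congrArg Cardinal.toENat hr'
  simp only [map_add, Cardinal.toENat_lift] at h' hr''
  rw [asdim_eq_rank, asdim_eq_rank, asdim_eq_rank, h', hr'', add_comm]

end AsymptoticDimension

theorem corollary3p3 :
    (∀ (B : Type u) (A : Type v) (C : Type w) [AddCommGroup B] [AddCommGroup A] [AddCommGroup C]
      (i : B →+ A) (p : A →+ C),
      Function.Injective i → Function.Exact i p → Function.Surjective p →
        AsymptoticDimension.asdim A =
          AsymptoticDimension.asdim B + AsymptoticDimension.asdim C) ∧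
    (∀ (A : Type u) (B : Type v) [AddCommGroup A] [AddCommGroup B],
      AsymptoticDimension.asdim (A × B) =
        AsymptoticDimension.asdim A + AsymptoticDimension.asdim B) := by
  refine ⟨fun B A C _ _ _ i p => AsymptoticDimension.asdim_eq_add_of_exact i p, fun A B _ _ => ?_⟩
  exact AsymptoticDimension.asdim_eq_add_of_exact (AddMonoidHom.inl A B) (AddMonoidHom.snd A B)
    (Prod.mk_left_injective 0) (fun x =>
      ⟨fun h => ⟨x.1, Prod.ext rfl (Eq.symm h)⟩, by rintro ⟨a, rfl⟩; rfl⟩)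
    Prod.snd_surjective
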